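/- Let $N\ge 2$, $\mathbb Z_N=\{0,\dots,N-1\}$, and let $\mathcal K_N=\mathbb Z_N^{\mathbb N}$ be the space of infinite words $x=x_1x_2\dots$ with its product topology and Borel $\sigma$-algebra; let $\sigma(x_1x_2x_3\dots)=x_2x_3\dots$ be the one-sided shift. Let $\lambda=(\lambda_i)_{i\in\mathbb Z_N}$ be a probability vector with $\lambda_i>0$ for all $i$, and let $T^{(n)}$, $n\ge 1$, be $N\times N$ matrices with positive entries, each of whose rows sums to $1$, such that $\lambda T^{(1)}=\lambda$. Let $\mu$ be the associated Markov measure, that is, the Borel probability measure on $\mathcal K_N$ with $$\mu(\{x : x_1=i_1,\dots,x_n=i_n\})=\lambda_{i_1}T^{(1)}_{i_1,i_2}T^{(2)}_{i_2,i_3}\cdots T^{(n-1)}_{i_{n-1},i_n}$$ for all finite words $i_1\dots i_n$. Assume that $\mu$ is quasi-stationary: $$\sum_{n=1}^\infty\left|\frac{T^{(n)}_{x_n,x_{n+1}}}{T^{(n+1)}_{x_n,x_{n+1}}}-1\right|<\infty\qquad\text{for all } x_1x_2\dots\in\mathcal K_N.$$ Put $$F(x_1x_2\dots)=\prod_{n=1}^\infty\frac{T^{(n)}_{x_n,x_{n+1}}}{T^{(n+1)}_{x_n,x_{n+1}}},\qquad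 f_j(x_1x_2\dots)=\delta_{j,x_1}\sqrt{\frac{\lambda_{x_2}}{\lambda_{x_1}T^{(1)}_{x_1,x_2}}\,F(x_2x_3\dots)}\qquad(j\in\mathbb Z_N).$$ Then: (i) $\mu$ is ergodic with respect to $\sigma$: $\sigma$ is nonsingular ($\mu(A)=0$ implies $\mu(\sigma^{-1}(A))=0$ for Borel $A$), and every Borel set $A$ with $\sigma^{-1}(A)=A$ satisfies $\mu(A)=0$ or $\mu(\mathcal K_N\setminus A)=0$. (ii) The formula $S_jg=f_j\cdot(g\circ\sigma)$, $g\in L^2(\mu)$, $j\in\mathbb Z_N$, defines bounded operators on the complex Hilbert space $L^2(\mu)$ that form a representation of the Cuntz algebra $\mathcal O_N$, i.e. $S_i^*S_j=\delta_{ij}I$ and $\sum_{i}S_iS_i^*=I$. This representation is monic (for some $\varphi\in L^2(\mu)$ the vectors $S_IS_I^*\varphi$, where $S_I=S_{i_1}\cdots S_{i_n}$ and $I=i_1\dots i_n$ runs over all finite words, span a dense subspace), and it is irreducible: $L^2(\mu)\neq 0$, and the only closed subspaces invariant under all $S_i$ and $S_i^*$ are $\{0\}$ and $L^2(\mu)$.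 -/

import Mathlib

open MeasureTheory ProbabilityTheory
open scoped ENNReal

/-- Infinite words `ω₁ω₂…` over the alphabet `{0, …, N-1}`, with letters indexed from `0`: the letter
`ω_{n+1}` is `ω n`.  The sigma-algebra is the product one, which is the Borel sigma-algebra of
the product topology. -/
abbrev Words (N : ℕ) : Type := ℕ → Fin N

/-- The one-sided shift `ω₁ω₂ω₃… ↦ ω₂ω₃…`. -/
def shift {N : ℕ} (ω : Words N) : Words N := fun n => ω (n + 1)

/-- The data `(λ, T)` of a Markov measure: `init` is the positive probability vector `λ`, and
`trans n` is the stochastic matrix with positive entries `T^{(n+1)}`; moreover `λ T^{(1)} = λ`. -/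
structure MarkovData (N : ℕ) where
  init : Fin N → ℝ
  trans : ℕ → Matrix (Fin N) (Fin N) ℝ
  init_pos : ∀ i, 0 < init i
  init_sum : ∑ i, init i = 1
  trans_pos : ∀ n i j, 0 < trans n i j
  trans_sum : ∀ n i, ∑ j, trans n i j = 1
  init_vecMul : Matrix.vecMul init (trans 0) = init

namespace MarkovData

variable {N : ℕ} (d : MarkovData N)

/-- The quasi-stationary condition
`∑ₙ |T^{(n)}_{x_n,x_{n+1}} / T^{(n+1)}_{x_n,x_{n+1}} - 1| < ∞` for every infinite word `x`. -/
def IsQuasiStationary : Prop :=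
  ∀ x : Words N, Summable fun n : ℕ =>
    |d.trans n (x n) (x (n + 1)) / d.trans (n + 1) (x n) (x (n + 1)) - 1|

/-- The measure on a finite alphabet with the given point masses. -/
noncomputable def weightMeasure (p : Fin N → ℝ) : Measure (Fin N) :=
  Measure.sum fun i => ENNReal.ofReal (p i) • Measure.dirac i

theorem weightMeasure_singleton (p : Fin N → ℝ) (i : Fin N) :
    weightMeasure p {i} = ENNReal.ofReal (p i) := by
  rw [weightMeasure, Measure.sum_apply _ (measurableSet_singleton i), tsum_eq_single i]
  · simp
  · intro j hj
    simp [hj]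

theorem isProbabilityMeasure_weightMeasure (p : Fin N → ℝ) (hp : ∀ i, 0 < p i)
    (hs : ∑ i, p i = 1) : IsProbabilityMeasure (weightMeasure p) := by
  constructor
  rw [weightMeasure, Measure.sum_apply _ MeasurableSet.univ, tsum_fintype]
  simp only [Measure.smul_apply, measure_univ, smul_eq_mul, mul_one]
  rw [← ENNReal.ofReal_sum_of_nonneg fun i _ => (hp i).le, hs, ENNReal.ofReal_one]

instance isProbabilityMeasure_init : IsProbabilityMeasure (weightMeasure d.init) :=
  isProbabilityMeasure_weightMeasure _ d.init_pos d.init_sum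

/-- The transition kernel from the first `n + 1` letters to the next letter: given the letter `i` in
position `n`, the next letter is `j` with probability `trans n i j`. -/
noncomputable def stepKernel (n : ℕ) : Kernel ((_ : Finset.Iic n) → Fin N) (Fin N) where
  toFun x := weightMeasure (d.trans n (x ⟨n, Finset.mem_Iic.2 le_rfl⟩))
  measurable' := Measurable.of_discrete

instance isMarkovKernel_stepKernel (n : ℕ) : IsMarkovKernel (d.stepKernel n) :=
  ⟨fun _ => isProbabilityMeasure_weightMeasure _ (d.trans_pos n _) (d.trans_sum n _)⟩

/-- The Markov measure `μ_{λ,T}` on infinite words: the law of the trajectory that starts with `λ`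
and makes its successive steps with the matrices `T^{(1)}, T^{(2)}, …`. -/
noncomputable def measure : Measure (Words N) :=
  Kernel.trajMeasure (X := fun _ => Fin N) (weightMeasure d.init) d.stepKernel

instance isProbabilityMeasure_measure : IsProbabilityMeasure d.measure := by
  unfold measure; infer_instance

/-- The values of the Markov measure on cylinder sets, which determine it:
`μ {ω | ω₁ = i₁, …, ω_{n+1} = i_{n+1}} = λ_{i₁} T^{(1)}_{i₁,i₂} ⋯ T^{(n)}_{i_n,i_{n+1}}`. -/
theorem measure_cylinder (n : ℕ) (w : Words N) :
    d.measure {ω | ∀ k ≤ n, ω k = w k} =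
      ENNReal.ofReal (d.init (w 0) * ∏ k ∈ Finset.range n, d.trans k (w k) (w (k + 1))) := by
  induction n with
  | zero =>
    have hm : d.measure.map (Preorder.frestrictLe (π := fun _ => Fin N) 0) =
        (weightMeasure d.init).map
          (MeasurableEquiv.piUnique (fun _ : Finset.Iic 0 => Fin N)).symm := by
      rw [measure, Kernel.trajMeasure, Measure.map_comp _ _ (by fun_prop),
        Kernel.traj_map_frestrictLe, Kernel.partialTraj_self, Measure.id_comp]
    have hs : {ω : Words N | ∀ k ≤ 0, ω k = w k} =
        Preorder.frestrictLe (π := fun _ => Fin N) 0 ⁻¹'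
          {x | x ⟨0, Finset.mem_Iic.2 le_rfl⟩ = w 0} := by
      ext ω
      simp [Preorder.frestrictLe]
    rw [hs, ← Measure.map_apply (by fun_prop) (MeasurableSet.of_discrete), hm,
      Measure.map_apply (by fun_prop) (MeasurableSet.of_discrete)]
    have : (MeasurableEquiv.piUnique (fun _ : Finset.Iic 0 => Fin N)).symm ⁻¹'
          {x | x ⟨0, Finset.mem_Iic.2 le_rfl⟩ = w 0} = {w 0} := by
      ext i
      simp [MeasurableEquiv.piUnique, Equiv.piUnique]
    rw [this, weightMeasure_singleton]
    simp
  | succ n ih =>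
    have key := Kernel.map_frestrictLe_trajMeasure_compProd_eq_map_trajMeasure
      (X := fun _ => Fin N) (μ₀ := weightMeasure d.init) (κ := d.stepKernel) (a := n)
    change d.measure.map _ ⊗ₘ _ = d.measure.map _ at key
    set A : Set ((_ : Finset.Iic n) → Fin N) := {x | ∀ k, x k = w k} with hA
    have hs : {ω : Words N | ∀ k ≤ n + 1, ω k = w k} =
        (fun ω : Words N => (Preorder.frestrictLe (π := fun _ => Fin N) n ω, ω (n + 1))) ⁻¹'
          (A ×ˢ {w (n + 1)}) := by
      ext ω
      simp only [Set.mem_ofPred_eq, Set.mem_preimage, Set.mem_prod, Set.mem_singleton_iff, hA,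
        Preorder.frestrictLe_apply, Subtype.forall, Finset.mem_Iic]
      constructor
      · exact fun h => ⟨fun k hk => h k (by omega), h _ le_rfl⟩
      · rintro ⟨h1, h2⟩ k hk
        rcases Nat.lt_or_ge n k with h | h
        · obtain rfl : k = n + 1 := by omega
          exact h2
        · exact h1 k h
    have hs' : {ω : Words N | ∀ k ≤ n, ω k = w k} =
        Preorder.frestrictLe (π := fun _ => Fin N) n ⁻¹' A := by
      ext ω
      simp [hA]
    rw [hs, ← Measure.map_apply (by fun_prop) (MeasurableSet.of_discrete), ← key,
      Measure.compProd_apply_prod (MeasurableSet.of_discrete) (MeasurableSet.of_discrete),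
      setLIntegral_congr_fun
        (g := fun _ => ENNReal.ofReal (d.trans n (w n) (w (n + 1)))) (MeasurableSet.of_discrete),
      setLIntegral_const, Measure.map_apply (by fun_prop) (MeasurableSet.of_discrete), ← hs', ih,
      ← ENNReal.ofReal_mul (d.trans_pos _ _ _).le, Finset.prod_range_succ]
    · congr 1
      ring
    · intro x hx
      change weightMeasure (d.trans n (x ⟨n, Finset.mem_Iic.2 le_rfl⟩)) _ = _
      rw [weightMeasure_singleton, hx ⟨n, Finset.mem_Iic.2 le_rfl⟩]

/-- The infinite product `F(x) = ∏ₙ T^{(n)}_{x_n,x_{n+1}} / T^{(n+1)}_{x_n,x_{n+1}}`. -/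
noncomputable def F (x : Words N) : ℝ :=
  ∏' n : ℕ, d.trans n (x n) (x (n + 1)) / d.trans (n + 1) (x n) (x (n + 1))

/-- For quasi-stationary data the product that defines `F` converges. -/
theorem multipliable_F (hd : d.IsQuasiStationary) (x : Words N) :
    Multipliable fun n : ℕ =>
      d.trans n (x n) (x (n + 1)) / d.trans (n + 1) (x n) (x (n + 1)) := by
  have h := Real.multipliable_one_add_of_summable (hd x).of_abs
  simpa using h

/-- The functions
`f_j(x) = δ_{j,x₁} √(λ_{x₂} / (λ_{x₁} T^{(1)}_{x₁,x₂}) · F(x₂x₃…))`. -/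
noncomputable def f (j : Fin N) (x : Words N) : ℝ :=
  if x 0 = j then
    Real.sqrt (d.init (x 1) / (d.init (x 0) * d.trans 0 (x 0) (x 1)) * d.F (shift x))
  else 0

/-- The operators `S` are those of the representation associated to `(λ, T)`: `S_j g = f_j (g ∘ σ)`
for every square-integrable function `g`. -/
def IsAssociatedRep (S : Fin N → (Lp ℂ 2 d.measure →L[ℂ] Lp ℂ 2 d.measure)) : Prop :=
  ∀ (j : Fin N) (g : Words N → ℂ) (hg : MemLp g 2 d.measure),
    S j (hg.toLp g) =ᵐ[d.measure] fun x => (d.f j x : ℂ) * g (shift x)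

end MarkovData

section Cuntz

variable {N : ℕ} {H : Type*} [NormedAddCommGroup H] [InnerProductSpace ℂ H] [CompleteSpace H]

/-- A representation of the Cuntz algebra `O_N` on `H`, given by the images of the generators:
`S_i^* S_j = δ_{ij} I` and `∑ S_i S_i^* = I`. -/
structure IsCuntzRep (S : Fin N → (H →L[ℂ] H)) : Prop where
  adjoint_mul : ∀ i j, (S i).adjoint * S j = if i = j then 1 else 0
  sum_mul_adjoint : ∑ i, S i * (S i).adjoint = 1

/-- `S_I = S_{i₁} ⋯ S_{i_n}` for a finite word `I = i₁…i_n`. -/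
noncomputable def wordOp (S : Fin N → (H →L[ℂ] H)) (I : List (Fin N)) : H →L[ℂ] H :=
  (I.map S).prod

/-- Monic: some vector is cyclic for the abelian subalgebra generated by the `S_I S_I^*`. -/
def IsMonicRep (S : Fin N → (H →L[ℂ] H)) : Prop :=
  ∃ φ : H, closure (Submodule.span ℂ
    (Set.range fun I : List (Fin N) => (wordOp S I * (wordOp S I).adjoint) φ) : Set H) = Set.univ

/-- Irreducible: the space is nonzero, and the only closed subspaces that are invariant under all
generators `S_i` and their adjoints are `0` and the whole space. -/
def IsIrreducibleRep (S : Fin N → (H →L[ℂ] H)) : Prop :=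
  Nontrivial H ∧ ∀ M : Submodule ℂ H, IsClosed (M : Set H) →
    (∀ i, ∀ x ∈ M, S i x ∈ M ∧ (S i).adjoint x ∈ M) → M = ⊥ ∨ M = ⊤

end Cuntz

/-! The alphabet is finite, so quasi-stationarity gives a uniform bound on all finite products of
ratios `T^{(k)}_{ij} / T^{(k+1)}_{ij}`. Hence all transition probabilities are at least some `c >
0`, and the truncations of `f_j²` are uniformly bounded.

On cylinders the truncated densities telescope exactly, so dominated convergence shows that `σ`
pushes `f_j² μ` forward to `μ` (`map_shift_withDensity`). This identity makes `S_j` an isometry and,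
since `f_j > 0` on the words beginning with `j`, makes `σ` nonsingular.

For ergodicity, the conditional laws of the future given two cylinders of equal length differ only
in the first transition factor, which lies in `[c, 1]`. An invariant set `A` then satisfies `c μ(A)
μ ≤ μ|_A`, and evaluation on the complement of `A` gives the dichotomy.

The projections `S_I S_I^*` are multiplications by cylinder indicators, so `k` orthogonal to all
`S_I S_I^* g` means that `g` and `k` have disjoint supports (`ae_eq_zero_or_eq_zero`). With `g = 1`
this is monicity. For a reducing subspace `M`, the support of the projection of `1` to `M` is
shift-invariant modulo null sets, and ergodicity makes `M` trivial. -/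

/-! ### Cylinder sets -/

/-- The cylinder set of the words that agree with `w` in the positions `0, …, n`. -/
abbrev cyl {N : ℕ} (n : ℕ) (w : Words N) : Set (Words N) := {ω | ∀ k ≤ n, ω k = w k}

/-- The word `j w₁ w₂ …`. -/
def consWord {N : ℕ} (j : Fin N) (w : Words N) : Words N
  | 0 => j
  | n + 1 => w n

/-- The word whose letters in the positions `0, …, n` are those of `w` and which continues with
`v`. -/
def appendWord {N : ℕ} (n : ℕ) (w v : Words N) : Words N :=
  fun k => if k ≤ n then w k else v (k - (n + 1))

section Cylinders

variable {N : ℕ}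

theorem measurable_shift : Measurable (shift (N := N)) :=
  measurable_pi_lambda _ fun n => measurable_pi_apply (n + 1)

theorem shift_iterate_apply (n : ℕ) (x : Words N) (k : ℕ) : shift^[n] x k = x (n + k) := by
  induction n generalizing k with
  | zero => simp
  | succ n ih =>
    rw [Function.iterate_succ_apply', shift, ih]
    congr 1
    omega

theorem consWord_shift (x : Words N) : consWord (x 0) (shift x) = x := by
  funext n
  cases n <;> rfl

theorem measurable_consWord (j : Fin N) : Measurable (consWord (N := N) j) := by
  refine measurable_pi_lambda _ fun n => ?_
  cases n with
  | zero => exact measurable_const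
  | succ n => exact measurable_pi_apply n

theorem cyl_eq_preimage {n m : ℕ} (h : n ≤ m) (w : Words N) :
    cyl n w = Preorder.frestrictLe (π := fun _ => Fin N) m ⁻¹'
      {x | ∀ (k : ℕ) (hk : k ≤ n), x ⟨k, Finset.mem_Iic.2 (hk.trans h)⟩ = w k} := by
  ext ω
  simp [Preorder.frestrictLe]

theorem measurableSet_cyl (n : ℕ) (w : Words N) : MeasurableSet (cyl n w) := by
  rw [cyl_eq_preimage le_rfl]
  exact (by fun_prop : Measurable (Preorder.frestrictLe (π := fun _ => Fin N) n))
    MeasurableSet.of_discrete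

theorem cyl_zero (w : Words N) : cyl 0 w = {x | x 0 = w 0} := by
  ext x
  simp

theorem cyl_succ (n : ℕ) (w : Words N) :
    cyl (n + 1) w = {x | x 0 = w 0} ∩ shift ⁻¹' cyl n (shift w) := by
  ext x
  constructor
  · exact fun h => ⟨h 0 (Nat.zero_le _), fun k hk => h (k + 1) (by omega)⟩
  · rintro ⟨h0, h1⟩ k hk
    cases k with
    | zero => exact h0
    | succ k => exact h1 k (by omega)

/-- Such a preimage is a finite disjoint union of cylinders of the same length, so the inequality
can be summed. -/
theorem measure_preimage_frestrictLe_le [NeZero N] {P Q : Measure (Words N)} (n : ℕ)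
    (h : ∀ w, P (cyl n w) ≤ Q (cyl n w)) (S : Set ((_ : Finset.Iic n) → Fin N)) :
    P (Preorder.frestrictLe (π := fun _ => Fin N) n ⁻¹' S) ≤
      Q (Preorder.frestrictLe (π := fun _ => Fin N) n ⁻¹' S) := by
  have hr : Measurable (Preorder.frestrictLe (π := fun _ => Fin N) n) := by fun_prop
  have hsum : ∀ R : Measure (Words N),
      R (Preorder.frestrictLe (π := fun _ => Fin N) n ⁻¹' S) =
        ∑ x ∈ S.toFinite.toFinset, R (Preorder.frestrictLe (π := fun _ => Fin N) n ⁻¹' {x}) := by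
    intro R
    rw [← Measure.map_apply hr MeasurableSet.of_discrete]
    simp_rw [← Measure.map_apply hr (MeasurableSet.of_discrete (s := {_}))]
    rw [sum_measure_singleton]
    simp
  rw [hsum P, hsum Q]
  refine Finset.sum_le_sum fun x _ => ?_
  -- The letter `0` beyond position `n` is a filler that the cylinder does not see.
  have : Preorder.frestrictLe (π := fun _ => Fin N) n ⁻¹' {x} =
      cyl n (fun k => if hk : k ≤ n then x ⟨k, Finset.mem_Iic.2 hk⟩ else 0) := by
    rw [cyl_eq_preimage le_rfl]
    congr 1
    ext y
    simp only [Set.mem_singleton_iff, funext_iff, Set.mem_ofPred_eq, Subtype.forall, Finset.mem_Iic]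
    refine forall_congr' fun k => forall_congr' fun hk => ?_
    simp [hk]
  rw [this]
  exact h _

theorem measure_cyl_le_of_le [NeZero N] {P Q : Measure (Words N)} {n m : ℕ} (hnm : n ≤ m)
    (h : ∀ w, P (cyl m w) ≤ Q (cyl m w)) (w : Words N) : P (cyl n w) ≤ Q (cyl n w) := by
  rw [cyl_eq_preimage hnm]
  exact measure_preimage_frestrictLe_le m h _

theorem measure_univ_le_of_cyl [NeZero N] {P Q : Measure (Words N)} (n : ℕ)
    (h : ∀ w, P (cyl n w) ≤ Q (cyl n w)) : P Set.univ ≤ Q Set.univ :=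
  measure_preimage_frestrictLe_le n h Set.univ

/-- A finite measure that is dominated by another one on cylinder sets is dominated by it. -/
theorem measure_le_of_cyl [NeZero N] {P Q : Measure (Words N)} [IsFiniteMeasure P]
    [IsFiniteMeasure Q] (h : ∀ n w, P (cyl n w) ≤ Q (cyl n w)) : P ≤ Q := by
  -- Density is taken for `P + Q`, so that a single `t` approximates `s` for both measures.
  have hdense : (P + Q).MeasureDense (measurableCylinders fun _ : ℕ => Fin N) :=
    Measure.MeasureDense.of_generateFrom_isSetAlgebra_finite _ isSetAlgebra_measurableCylinders
      generateFrom_measurableCylinders.symm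
  refine Measure.le_iff.2 fun s hs => ENNReal.le_of_forall_pos_le_add fun ε hε _ => ?_
  obtain ⟨t, ht, hst⟩ := hdense.approx s hs (measure_ne_top _ _) ((ε : ℝ) / 2) (by positivity)
  rw [Measure.add_apply] at hst
  rw [measurableCylinders_nat] at ht
  obtain ⟨a, S, -, rfl⟩ : ∃ (a : ℕ) (S : Set ((_ : Finset.Iic a) → Fin N)),
      MeasurableSet S ∧ t = cylinder (α := fun _ => Fin N) (Finset.Iic a) S := by simpa using ht
  have hle : P (cylinder (α := fun _ => Fin N) (Finset.Iic a) S) ≤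
      Q (cylinder (α := fun _ => Fin N) (Finset.Iic a) S) :=
    measure_preimage_frestrictLe_le a (h a) S
  set t := cylinder (α := fun _ => Fin N) (Finset.Iic a) S
  have h1 : P s ≤ P t + P (symmDiff s t) := by
    refine (measure_mono ?_).trans (measure_union_le _ _)
    intro x hx
    by_cases hxt : x ∈ t
    · exact Or.inl hxt
    · exact Or.inr (Or.inl ⟨hx, hxt⟩)
  have h2 : Q t ≤ Q s + Q (symmDiff s t) := by
    refine (measure_mono ?_).trans (measure_union_le _ _)
    intro x hx
    by_cases hxs : x ∈ s
    · exact Or.inl hxs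
    · exact Or.inr (Or.inr ⟨hx, hxs⟩)
  have h3 : Q (symmDiff s t) + P (symmDiff s t) ≤ ε := by
    rw [add_comm]
    refine hst.le.trans (ENNReal.ofReal_le_of_le_toReal ?_)
    simp
  calc P s ≤ Q s + Q (symmDiff s t) + P (symmDiff s t) := by
        refine h1.trans ?_
        gcongr
        exact hle.trans h2
    _ ≤ Q s + ε := by
        rw [add_assoc]
        gcongr

theorem measure_eq_of_cyl [NeZero N] {P Q : Measure (Words N)} [IsFiniteMeasure P]
    [IsFiniteMeasure Q] (h : ∀ n w, P (cyl n w) = Q (cyl n w)) : P = Q :=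
  le_antisymm (measure_le_of_cyl fun n w => (h n w).le) (measure_le_of_cyl fun n w => (h n w).ge)

theorem cyl_inter_shift_iterate_preimage (n m : ℕ) (w v : Words N) :
    cyl n w ∩ shift^[n + 1] ⁻¹' cyl m v = cyl (n + 1 + m) (appendWord n w v) := by
  ext x
  simp only [Set.mem_inter_iff, Set.mem_preimage, Set.mem_ofPred_eq, shift_iterate_apply,
    appendWord]
  constructor
  · rintro ⟨h1, h2⟩ k hk
    split_ifs with hkn
    · exact h1 k hkn
    · have := h2 (k - (n + 1)) (by omega)
      rwa [Nat.add_sub_cancel' (by omega)] at this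
  · intro h
    refine ⟨fun k hk => ?_, fun k hk => ?_⟩
    · have := h k (by omega)
      rwa [if_pos hk] at this
    · have := h (n + 1 + k) (by omega)
      rwa [if_neg (by omega), Nat.add_sub_cancel_left] at this

end Cylinders

/-! ### The Markov property on cylinders. -/

namespace MarkovData

variable {N : ℕ} (d : MarkovData N)

theorem neZero {N : ℕ} (d : MarkovData N) : NeZero N := by
  refine ⟨fun h => ?_⟩
  subst h
  simpa using d.init_sum

theorem trans_le_one (n : ℕ) (i j : Fin N) : d.trans n i j ≤ 1 := by
  rw [← d.trans_sum n i]
  exact Finset.single_le_sum (fun j _ => (d.trans_pos n i j).le) (Finset.mem_univ j)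

theorem measure_cyl (n : ℕ) (w : Words N) :
    d.measure (cyl n w) =
      ENNReal.ofReal (d.init (w 0) * ∏ k ∈ Finset.range n, d.trans k (w k) (w (k + 1))) :=
  d.measure_cylinder n w

/-- The Markov property on cylinder sets. -/
theorem measure_cyl_inter_shift_iterate_preimage (n m : ℕ) (w v : Words N) :
    d.measure (cyl n w ∩ shift^[n + 1] ⁻¹' cyl m v) =
      d.measure (cyl n w) * ENNReal.ofReal (d.trans n (w n) (v 0) *
        ∏ k ∈ Finset.range m, d.trans (n + 1 + k) (v k) (v (k + 1))) := by
  have hnn : 0 ≤ d.init (w 0) * ∏ k ∈ Finset.range n, d.trans k (w k) (w (k + 1)) :=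
    mul_nonneg (d.init_pos _).le (Finset.prod_nonneg fun k _ => (d.trans_pos _ _ _).le)
  rw [cyl_inter_shift_iterate_preimage, measure_cyl, measure_cyl, ← ENNReal.ofReal_mul hnn,
    Finset.prod_range_add, Finset.prod_range_succ]
  have h1 : ∏ k ∈ Finset.range n, d.trans k (appendWord n w v k) (appendWord n w v (k + 1)) =
      ∏ k ∈ Finset.range n, d.trans k (w k) (w (k + 1)) := by
    refine Finset.prod_congr rfl fun k hk => ?_
    have := Finset.mem_range.1 hk
    simp [appendWord, this.le, Nat.succ_le_of_lt this]
  have h2 : ∏ k ∈ Finset.range m, d.trans (n + 1 + k) (appendWord n w v (n + 1 + k))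
        (appendWord n w v (n + 1 + k + 1)) =
      ∏ k ∈ Finset.range m, d.trans (n + 1 + k) (v k) (v (k + 1)) := by
    refine Finset.prod_congr rfl fun k _ => ?_
    have e1 : n + 1 + k - (n + 1) = k := by omega
    have e2 : n + 1 + k + 1 - (n + 1) = k + 1 := by omega
    simp only [appendWord, e1, e2]
    rw [if_neg (by omega), if_neg (by omega)]
  rw [h1, h2]
  simp only [appendWord, Nat.zero_le, if_true, le_refl, Nat.sub_self]
  rw [if_neg (by omega)]
  congr 1
  ring

end MarkovData

/-! ### Uniform bounds from quasi-stationarity. -/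

namespace MarkovData

variable {N : ℕ} (d : MarkovData N)

/-- The ratio `T^{(k)}_{ij} / T^{(k+1)}_{ij}` of successive transition probabilities. -/
noncomputable def ratio (k : ℕ) (i j : Fin N) : ℝ := d.trans k i j / d.trans (k + 1) i j

theorem ratio_pos (k : ℕ) (i j : Fin N) : 0 < d.ratio k i j :=
  div_pos (d.trans_pos _ _ _) (d.trans_pos _ _ _)

variable {d}

/-- The hypothesis only speaks of words. The alternating words `ijij…` and `jiji…` together exhibit
the transition from `i` to `j` at every time: the former at even times, the latter at odd ones. -/
theorem IsQuasiStationary.summable_ratio (hd : d.IsQuasiStationary) (i j : Fin N) :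
    Summable fun k => |d.ratio k i j - 1| := by
  have h1 := hd fun n => if Even n then i else j
  have h2 := hd fun n => if Even n then j else i
  refine Summable.of_nonneg_of_le (fun _ => abs_nonneg _) (fun k => ?_) (h1.add h2)
  by_cases hk : Even k
  · simp only [hk, Nat.even_add_one, not_true_eq_false, if_true, if_false]
    exact le_add_of_nonneg_right (abs_nonneg _)
  · simp only [hk, Nat.even_add_one, not_false_eq_true, if_true, if_false]
    exact le_add_of_nonneg_left (abs_nonneg _)

/-- Each term is dominated by the sum over all pairs of letters, so the exponential of the total sum
bounds every product. The sequences `x` and `y` are independent, which allows a fixed pair `(i, j)`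
at all times. -/
theorem IsQuasiStationary.exists_prod_ratio_le (hd : d.IsQuasiStationary) :
    ∃ K : ℝ, 0 < K ∧ ∀ (n : ℕ) (x y : ℕ → Fin N),
      ∏ k ∈ Finset.range n, d.ratio k (x k) (y k) ≤ K := by
  refine ⟨Real.exp (∑ i, ∑ j, ∑' k, |d.ratio k i j - 1|), Real.exp_pos _, fun n x y => ?_⟩
  have h1 : ∏ k ∈ Finset.range n, d.ratio k (x k) (y k) ≤
      ∏ k ∈ Finset.range n, (1 + |d.ratio k (x k) (y k) - 1|) :=
    Finset.prod_le_prod (fun k _ => (d.ratio_pos _ _ _).le) fun k _ => by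
      linarith [le_abs_self (d.ratio k (x k) (y k) - 1)]
  refine h1.trans ((Real.prod_one_add_le_exp_sum _ fun _ => abs_nonneg _).trans
    (Real.exp_le_exp.2 ?_))
  calc ∑ k ∈ Finset.range n, |d.ratio k (x k) (y k) - 1|
      ≤ ∑ k ∈ Finset.range n, ∑ i, ∑ j, |d.ratio k i j - 1| := by
        refine Finset.sum_le_sum fun k _ => ?_
        refine le_trans ?_ (Finset.single_le_sum
          (fun i _ => Finset.sum_nonneg fun j _ => abs_nonneg _) (Finset.mem_univ (x k)))
        exact Finset.single_le_sum (f := fun j => |d.ratio k (x k) j - 1|)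
          (fun j _ => abs_nonneg _) (Finset.mem_univ (y k))
    _ = ∑ i, ∑ j, ∑ k ∈ Finset.range n, |d.ratio k i j - 1| := by
        rw [Finset.sum_comm]
        refine Finset.sum_congr rfl fun i _ => Finset.sum_comm
    _ ≤ ∑ i, ∑ j, ∑' k, |d.ratio k i j - 1| :=
        Finset.sum_le_sum fun i _ => Finset.sum_le_sum fun j _ =>
          (hd.summable_ratio i j).sum_le_tsum _ fun _ _ => abs_nonneg _

theorem prod_ratio_eq_div (n : ℕ) (i j : Fin N) :
    ∏ k ∈ Finset.range n, d.ratio k i j = d.trans 0 i j / d.trans n i j := by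
  induction n with
  | zero => simp [div_self (d.trans_pos 0 i j).ne']
  | succ n ih =>
    have := (d.trans_pos n i j).ne'
    rw [Finset.prod_range_succ, ih, ratio]
    field_simp

/-- The transition probabilities of quasi-stationary data are bounded away from zero. -/
theorem IsQuasiStationary.exists_le_trans (hd : d.IsQuasiStationary) :
    ∃ c : ℝ, 0 < c ∧ ∀ n i j, c ≤ d.trans n i j := by
  obtain ⟨K, hK, hle⟩ := hd.exists_prod_ratio_le
  have := d.neZero
  obtain ⟨⟨i₀, j₀⟩, h₀⟩ := Finite.exists_min fun p : Fin N × Fin N => d.trans 0 p.1 p.2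
  refine ⟨d.trans 0 i₀ j₀ / K, div_pos (d.trans_pos _ _ _) hK, fun n i j => ?_⟩
  -- For a constant pair the product telescopes to `trans 0 i j / trans n i j`.
  have h := hle n (fun _ => i) fun _ => j
  rw [prod_ratio_eq_div, div_le_iff₀ (d.trans_pos n i j)] at h
  rw [div_le_iff₀ hK, mul_comm]
  exact (h₀ (i, j)).trans h

theorem IsQuasiStationary.tendsto_prod_ratio (hd : d.IsQuasiStationary) (x : Words N) :
    Filter.Tendsto (fun n => ∏ k ∈ Finset.range n, d.ratio k (x k) (x (k + 1))) Filter.atTop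
      (nhds (d.F x)) :=
  (d.multipliable_F hd x).hasProd.tendsto_prod_nat

/-- A limit of positive products might vanish; summability of the logarithms excludes this. -/
theorem IsQuasiStationary.F_pos (hd : d.IsQuasiStationary) (x : Words N) : 0 < d.F x := by
  have hs : Summable fun k => Real.log (d.ratio k (x k) (x (k + 1))) := by
    simpa [ratio] using Real.summable_log_one_add_of_summable (hd x).of_abs
  exact (Real.exp_pos _).trans_eq (Real.rexp_tsum_eq_tprod (fun k => d.ratio_pos k _ _) hs)

theorem measurable_prod_ratio (n : ℕ) :
    Measurable fun x : Words N => ∏ k ∈ Finset.range n, d.ratio k (x k) (x (k + 1)) := by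
  refine Finset.measurable_prod _ fun k _ => ?_
  exact (Measurable.of_discrete (f := fun p : Fin N × Fin N => d.ratio k p.1 p.2)).comp
    (by fun_prop : Measurable fun x : Words N => (x k, x (k + 1)))

theorem IsQuasiStationary.measurable_F (hd : d.IsQuasiStationary) : Measurable d.F :=
  measurable_of_tendsto_metrizable measurable_prod_ratio
    (tendsto_pi_nhds.2 fun x => hd.tendsto_prod_ratio x)

variable (d) in
/-- The factor `λ_{x₂} / (λ_{x₁} T^{(1)}_{x₁,x₂})` of the squares of the functions `f_j`. -/
noncomputable def headFactor (x : Words N) : ℝ :=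
  d.init (x 1) / (d.init (x 0) * d.trans 0 (x 0) (x 1))

theorem headFactor_pos (x : Words N) : 0 < d.headFactor x :=
  div_pos (d.init_pos _) (mul_pos (d.init_pos _) (d.trans_pos _ _ _))

theorem measurable_headFactor : Measurable d.headFactor :=
  (Measurable.of_discrete
    (f := fun p : Fin N × Fin N => d.init p.2 / (d.init p.1 * d.trans 0 p.1 p.2))).comp
    (by fun_prop : Measurable fun x : Words N => (x 0, x 1))

theorem exists_headFactor_le : ∃ K : ℝ, 0 < K ∧ ∀ x, d.headFactor x ≤ K := by
  have := d.neZero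
  obtain ⟨p, hp⟩ := Finite.exists_max
    fun p : Fin N × Fin N => d.init p.2 / (d.init p.1 * d.trans 0 p.1 p.2)
  exact ⟨_, div_pos (d.init_pos _) (mul_pos (d.init_pos _) (d.trans_pos _ _ _)),
    fun x => hp (x 0, x 1)⟩

theorem measurableSet_letter (j : Fin N) : MeasurableSet {x : Words N | x 0 = j} :=
  (measurable_pi_apply (X := fun _ : ℕ => Fin N) 0) (measurableSet_singleton j)

theorem f_eq (j : Fin N) (x : Words N) :
    d.f j x = if x 0 = j then √(d.headFactor x * d.F (shift x)) else 0 := rfl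

theorem IsQuasiStationary.measurable_f (hd : d.IsQuasiStationary) (j : Fin N) :
    Measurable (d.f j) :=
  Measurable.ite (measurableSet_letter j)
    (measurable_headFactor.mul (hd.measurable_F.comp measurable_shift)).sqrt measurable_const

theorem IsQuasiStationary.f_pos (hd : d.IsQuasiStationary) {j : Fin N} {x : Words N}
    (hx : x 0 = j) : 0 < d.f j x := by
  rw [f_eq, if_pos hx]
  exact Real.sqrt_pos.2 (mul_pos (headFactor_pos x) (hd.F_pos _))

theorem f_nonneg (j : Fin N) (x : Words N) : 0 ≤ d.f j x := by
  rw [f_eq]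
  split_ifs
  exacts [Real.sqrt_nonneg _, le_rfl]

theorem f_of_ne {j : Fin N} {x : Words N} (hx : x 0 ≠ j) : d.f j x = 0 := by
  rw [f_eq, if_neg hx]

theorem IsQuasiStationary.f_sq (hd : d.IsQuasiStationary) (j : Fin N) (x : Words N) :
    d.f j x ^ 2 = if x 0 = j then d.headFactor x * d.F (shift x) else 0 := by
  rw [f_eq]
  split_ifs
  · exact Real.sq_sqrt (mul_pos (headFactor_pos x) (hd.F_pos _)).le
  · simp

/-! ### The Radon–Nikodym derivatives of the shift branches -/

variable (d) in
/-- The approximation of `f_j²` in which the infinite product is truncated. -/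
noncomputable def approxDensity (j : Fin N) (n : ℕ) (x : Words N) : ℝ :=
  if x 0 = j then
    d.headFactor x * ∏ k ∈ Finset.range n, d.ratio k (shift x k) (shift x (k + 1)) else 0

theorem measurable_approxDensity (j : Fin N) (n : ℕ) : Measurable (d.approxDensity j n) :=
  Measurable.ite (measurableSet_letter j)
    (measurable_headFactor.mul ((measurable_prod_ratio n).comp measurable_shift)) measurable_const

theorem IsQuasiStationary.tendsto_approxDensity (hd : d.IsQuasiStationary) (j : Fin N)
    (x : Words N) :
    Filter.Tendsto (fun n => d.approxDensity j n x) Filter.atTop (nhds (d.f j x ^ 2)) := by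
  rw [hd.f_sq]
  by_cases hx : x 0 = j
  · simp only [approxDensity, if_pos hx]
    exact (hd.tendsto_prod_ratio (shift x)).const_mul _
  · simp only [approxDensity, if_neg hx]
    exact tendsto_const_nhds

theorem IsQuasiStationary.exists_approxDensity_le (hd : d.IsQuasiStationary) :
    ∃ K : ℝ, ∀ j n x, d.approxDensity j n x ≤ K := by
  obtain ⟨K, hK, hle⟩ := hd.exists_prod_ratio_le
  obtain ⟨K', hK', hle'⟩ := d.exists_headFactor_le
  refine ⟨K' * K, fun j n x => ?_⟩
  rw [approxDensity]
  split_ifs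
  · exact mul_le_mul (hle' x) (hle n _ _)
      (Finset.prod_nonneg fun k _ => (d.ratio_pos _ _ _).le) hK'.le
  · positivity

/-- With exactly `n` ratios the density is constant on the cylinder of `j w₀ … w_n`. There
`headFactor` replaces `λ_j T^{(1)}_{j,w₀}` by `λ_{w₀}`, and each ratio moves a transition matrix
back by one time step. -/
theorem setLIntegral_approxDensity_cyl (j : Fin N) (n : ℕ) (w : Words N) :
    ∫⁻ x in shift ⁻¹' cyl n w, ENNReal.ofReal (d.approxDensity j n x) ∂d.measure =
      d.measure (cyl n w) := by
  have hinter : shift ⁻¹' cyl n w ∩ {x | x 0 = j} = cyl (n + 1) (consWord j w) := by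
    rw [cyl_succ, Set.inter_comm]
    rfl
  have hind : ∀ x, ENNReal.ofReal (d.approxDensity j n x) = {x : Words N | x 0 = j}.indicator
      (fun x => ENNReal.ofReal (d.approxDensity j n x)) x := by
    intro x
    by_cases hx : x 0 = j
    · exact (Set.indicator_of_mem (s := {x : Words N | x 0 = j}) hx
        fun x => ENNReal.ofReal (d.approxDensity j n x)).symm
    · rw [Set.indicator_of_notMem (s := {x : Words N | x 0 = j}) hx, approxDensity, if_neg hx,
        ENNReal.ofReal_zero]
  rw [lintegral_congr hind, setLIntegral_indicator (measurableSet_letter j), Set.inter_comm,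
    hinter, setLIntegral_congr_fun
      (g := fun _ => ENNReal.ofReal (d.approxDensity j n (consWord j w))) (measurableSet_cyl _ _),
    setLIntegral_const, measure_cyl, measure_cyl]
  · have h0 := d.init_pos j
    have h1 := d.trans_pos 0 j (w 0)
    have happrox : d.approxDensity j n (consWord j w) = d.headFactor (consWord j w) *
        ∏ k ∈ Finset.range n, d.ratio k (w k) (w (k + 1)) := if_pos rfl
    have hnn : 0 ≤ d.approxDensity j n (consWord j w) := by
      rw [happrox]
      exact mul_nonneg (headFactor_pos _).le
        (Finset.prod_nonneg fun k _ => (d.ratio_pos _ _ _).le)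
    rw [← ENNReal.ofReal_mul hnn, happrox, headFactor, Finset.prod_range_succ']
    have hprod : (∏ k ∈ Finset.range n, d.ratio k (w k) (w (k + 1))) *
        ∏ k ∈ Finset.range n, d.trans (k + 1) (w k) (w (k + 1)) =
          ∏ k ∈ Finset.range n, d.trans k (w k) (w (k + 1)) := by
      rw [← Finset.prod_mul_distrib]
      exact Finset.prod_congr rfl fun k _ => div_mul_cancel₀ _ (d.trans_pos _ _ _).ne'
    rw [← hprod]
    simp only [consWord]
    congr 1
    field_simp
  · intro x hx
    simp only [approxDensity, headFactor]
    have e : ∀ k ≤ n + 1, x k = consWord j w k := hx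
    rw [e 0 (by omega), e 1 (by omega)]
    congr 3
    refine Finset.prod_congr rfl fun k hk => ?_
    have := Finset.mem_range.1 hk
    simp only [shift]
    rw [e (k + 1) (by omega), e (k + 1 + 1) (by omega)]

/-- The Markov measure is the image under the shift of the measure with density `f_j²`. -/
theorem IsQuasiStationary.map_shift_withDensity (hd : d.IsQuasiStationary) (j : Fin N) :
    (d.measure.withDensity fun x => ENNReal.ofReal (d.f j x ^ 2)).map shift = d.measure := by
  have := d.neZero
  have hmeas : ∀ n, Measurable fun x => ENNReal.ofReal (d.approxDensity j n x) :=
    fun n => (measurable_approxDensity j n).ennreal_ofReal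
  obtain ⟨K, hK⟩ := hd.exists_approxDensity_le
  have hcyl : ∀ n w, ∫⁻ x in shift ⁻¹' cyl n w, ENNReal.ofReal (d.f j x ^ 2) ∂d.measure =
      d.measure (cyl n w) := by
    intro n w
    have hlim : Filter.Tendsto
        (fun m => ∫⁻ x in shift ⁻¹' cyl n w, ENNReal.ofReal (d.approxDensity j m x) ∂d.measure)
        Filter.atTop
        (nhds (∫⁻ x in shift ⁻¹' cyl n w, ENNReal.ofReal (d.f j x ^ 2) ∂d.measure)) := by
      refine tendsto_lintegral_of_dominated_convergence (fun _ => ENNReal.ofReal K) hmeas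
        (fun m => ae_of_all _ fun x => ENNReal.ofReal_le_ofReal (hK j m x)) ?_
        (ae_of_all _ fun x => (ENNReal.continuous_ofReal.tendsto _).comp
          (hd.tendsto_approxDensity j x))
      rw [lintegral_const]
      exact ENNReal.mul_ne_top ENNReal.ofReal_ne_top (measure_ne_top _ _)
    refine tendsto_nhds_unique hlim (tendsto_const_nhds.congr' ?_)
    -- For `m ≥ n` the integral already has its limiting value: the identity holds on cylinders of
    -- level `m`, and a cylinder of level `n` is a union of these.
    filter_upwards [Filter.eventually_ge_atTop n] with m hm
    have hP : ∀ (s : Set (Words N)), MeasurableSet s →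
        (d.measure.withDensity fun x => ENNReal.ofReal (d.approxDensity j m x)).map shift s =
          ∫⁻ x in shift ⁻¹' s, ENNReal.ofReal (d.approxDensity j m x) ∂d.measure := by
      intro s hs
      rw [Measure.map_apply measurable_shift hs, withDensity_apply _ (measurable_shift hs)]
    have hm' : ∀ w,
        (d.measure.withDensity fun x => ENNReal.ofReal (d.approxDensity j m x)).map shift (cyl m w) =
          d.measure (cyl m w) := fun w => by
      rw [hP _ (measurableSet_cyl _ _), setLIntegral_approxDensity_cyl]
    rw [← hP _ (measurableSet_cyl _ _)]
    exact le_antisymm (measure_cyl_le_of_le hm (fun w => (hm' w).ge) w)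
      (measure_cyl_le_of_le hm (fun w => (hm' w).le) w)
  have hP : ∀ n w,
      (d.measure.withDensity fun x => ENNReal.ofReal (d.f j x ^ 2)).map shift (cyl n w) =
        d.measure (cyl n w) := by
    intro n w
    rw [Measure.map_apply measurable_shift (measurableSet_cyl _ _),
      withDensity_apply _ (measurable_shift (measurableSet_cyl _ _)), hcyl]
  have hfin : IsFiniteMeasure
      ((d.measure.withDensity fun x => ENNReal.ofReal (d.f j x ^ 2)).map shift) := by
    refine ⟨(measure_univ_le_of_cyl (Q := d.measure) 0 fun w => (hP 0 w).le).trans_lt ?_⟩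
    exact measure_lt_top _ _
  exact measure_eq_of_cyl hP

/-- If `s` is null, `f_j²` has integral zero over `σ⁻¹ s`; as `f_j > 0` on the words beginning with
`j`, each of the finitely many pieces of `σ⁻¹ s` is null. -/
theorem IsQuasiStationary.quasiMeasurePreserving_shift (hd : d.IsQuasiStationary) :
    Measure.QuasiMeasurePreserving (shift (N := N)) d.measure d.measure := by
  refine ⟨measurable_shift, Measure.AbsolutelyContinuous.mk fun s hs h0 => ?_⟩
  rw [Measure.map_apply measurable_shift hs]
  have hcover : shift ⁻¹' s ⊆ ⋃ j, {x : Words N | x 0 = j} ∩ shift ⁻¹' s :=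
    fun x hx => Set.mem_iUnion.2 ⟨x 0, rfl, hx⟩
  refine measure_mono_null hcover (measure_iUnion_null fun j => ?_)
  rw [← hd.map_shift_withDensity j, Measure.map_apply measurable_shift hs,
    withDensity_apply _ (measurable_shift hs),
    lintegral_eq_zero_iff ((hd.measurable_f j).pow_const 2).ennreal_ofReal,
    Filter.EventuallyEq, ae_restrict_iff' (measurable_shift hs)] at h0
  refine measure_mono_null ?_ (ae_iff.1 h0)
  rintro x ⟨hx0, hxs⟩ h
  have := h hxs
  simp only [Pi.zero_apply, ENNReal.ofReal_eq_zero] at this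
  exact absurd this (not_le.2 (pow_pos (hd.f_pos hx0) 2))

/-! ### Ergodicity -/

/-- The probability of an invariant set, given a cylinder, depends on the cylinder only up to a
constant factor. -/
theorem le_measure_cyl_inter {c : ℝ} (hc : 0 < c) (hle : ∀ n i j, c ≤ d.trans n i j) (n : ℕ)
    (w w' : Words N) {A : Set (Words N)} (hA : MeasurableSet A) :
    ENNReal.ofReal c * d.measure (cyl n w) * d.measure (cyl n w' ∩ shift^[n + 1] ⁻¹' A) ≤
      d.measure (cyl n w') * d.measure (cyl n w ∩ shift^[n + 1] ⁻¹' A) := by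
  have := d.neZero
  have hmap : ∀ (u : Words N) (s : Set (Words N)), MeasurableSet s →
      (d.measure.restrict (cyl n u)).map shift^[n + 1] s =
        d.measure (cyl n u ∩ shift^[n + 1] ⁻¹' s) := by
    intro u s hs
    rw [Measure.map_apply (measurable_shift.iterate _) hs,
      Measure.restrict_apply (measurable_shift.iterate _ hs), Set.inter_comm]
  have hfin : ∀ u u' : Words N, ∀ t : ℝ, IsFiniteMeasure
      ((ENNReal.ofReal t * d.measure (cyl n u)) •
        (d.measure.restrict (cyl n u')).map shift^[n + 1]) :=
    fun u u' t => Measure.smul_finite _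
      (ENNReal.mul_ne_top ENNReal.ofReal_ne_top (measure_ne_top _ _))
  have := hfin w w' c
  -- The harmless factor `ofReal 1` gives both measures the shape treated by `hfin`.
  have := hfin w' w 1
  have hmain : (ENNReal.ofReal c * d.measure (cyl n w)) •
        (d.measure.restrict (cyl n w')).map shift^[n + 1] ≤
      (ENNReal.ofReal 1 * d.measure (cyl n w')) •
        (d.measure.restrict (cyl n w)).map shift^[n + 1] := by
    refine measure_le_of_cyl fun m v => ?_
    simp only [Measure.smul_apply, smul_eq_mul]
    rw [hmap _ _ (measurableSet_cyl _ _), hmap _ _ (measurableSet_cyl _ _),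
      measure_cyl_inter_shift_iterate_preimage, measure_cyl_inter_shift_iterate_preimage]
    set p := ∏ k ∈ Finset.range m, d.trans (n + 1 + k) (v k) (v (k + 1))
    have hprod_nonneg : 0 ≤ p := Finset.prod_nonneg fun k _ => (d.trans_pos _ _ _).le
    -- The pasts `w` and `w'` enter only through the transition into `v 0`; the remaining product
    -- `p` is common.
    have hkey : ENNReal.ofReal c * ENNReal.ofReal (d.trans n (w' n) (v 0) * p) ≤
        ENNReal.ofReal (d.trans n (w n) (v 0) * p) := by
      rw [← ENNReal.ofReal_mul hc.le, ← mul_assoc]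
      refine ENNReal.ofReal_le_ofReal (mul_le_mul_of_nonneg_right ?_ hprod_nonneg)
      calc c * d.trans n (w' n) (v 0) ≤ c * 1 :=
            mul_le_mul_of_nonneg_left (d.trans_le_one _ _ _) hc.le
        _ ≤ d.trans n (w n) (v 0) := by rw [mul_one]; exact hle _ _ _
    calc _ = d.measure (cyl n w') * d.measure (cyl n w) *
          (ENNReal.ofReal c * ENNReal.ofReal (d.trans n (w' n) (v 0) * p)) := by ring
      _ ≤ d.measure (cyl n w') * d.measure (cyl n w) *
          ENNReal.ofReal (d.trans n (w n) (v 0) * p) := by gcongr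
      _ = _ := by rw [ENNReal.ofReal_one]; ring
  have h := Measure.le_iff.1 hmain A hA
  simp only [Measure.smul_apply, smul_eq_mul, hmap _ _ hA, ENNReal.ofReal_one, one_mul] at h
  exact h

theorem IsQuasiStationary.preErgodic_shift (hd : d.IsQuasiStationary) :
    PreErgodic (shift (N := N)) d.measure := by
  have := d.neZero
  obtain ⟨c, hc, hle⟩ := hd.exists_le_trans
  refine ⟨fun A hA hinv => ?_⟩
  have hiter : ∀ n, shift^[n] ⁻¹' A = A := by
    intro n
    induction n with
    | zero => rfl
    | succ n ih => rw [Function.iterate_succ, Set.preimage_comp, ih, hinv]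
  have hcylA : ∀ n w, ENNReal.ofReal c * d.measure A * d.measure (cyl n w) ≤
      d.measure (cyl n w ∩ A) := by
    intro n w
    -- Summing the comparison over all `w'` of the same length removes the second cylinder.
    have h := measure_univ_le_of_cyl
      (P := (ENNReal.ofReal c * d.measure (cyl n w)) • d.measure.restrict A)
      (Q := d.measure (cyl n w ∩ A) • d.measure) n fun w' => by
        have h := le_measure_cyl_inter hc hle n w w' hA
        rw [hiter] at h
        simp only [Measure.smul_apply, smul_eq_mul, Measure.restrict_apply (measurableSet_cyl _ _)]
        rwa [mul_comm (d.measure (cyl n w ∩ A))]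
    simp only [Measure.smul_apply, smul_eq_mul, Measure.restrict_apply_univ, measure_univ,
      mul_one] at h
    calc _ = _ := by ring
      _ ≤ _ := h
  have hfin : IsFiniteMeasure ((ENNReal.ofReal c * d.measure A) • d.measure) :=
    Measure.smul_finite _ (ENNReal.mul_ne_top ENNReal.ofReal_ne_top (measure_ne_top _ _))
  have hall : (ENNReal.ofReal c * d.measure A) • d.measure ≤ d.measure.restrict A := by
    refine measure_le_of_cyl fun n w => ?_
    rw [Measure.restrict_apply (measurableSet_cyl _ _)]
    exact hcylA n w
  have h := Measure.le_iff.1 hall Aᶜ hA.compl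
  rw [Measure.restrict_apply hA.compl, Set.compl_inter_self, measure_empty] at h
  simp only [Measure.smul_apply, smul_eq_mul, nonpos_iff_eq_zero, mul_eq_zero,
    ENNReal.ofReal_eq_zero, not_le.2 hc, false_or] at h
  rw [Filter.eventuallyConst_set']
  rcases h with h | h
  · exact Or.inl (ae_eq_empty.2 h)
  · exact Or.inr (ae_eq_univ.2 h)

theorem IsQuasiStationary.quasiErgodic_shift (hd : d.IsQuasiStationary) :
    QuasiErgodic (shift (N := N)) d.measure :=
  { hd.quasiMeasurePreserving_shift, hd.preErgodic_shift with }

end MarkovData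

/-! ### Functions determined by their integrals over cylinders. -/

section CylinderIntegrals

variable {N : ℕ} {μ : Measure (Words N)}

/-- The positive and negative parts are densities of finite measures that agree on cylinders, hence
coincide. -/
theorem ae_eq_zero_of_forall_setIntegral_cyl_real [NeZero N] {u : Words N → ℝ}
    (hu : Integrable u μ) (h : ∀ n w, ∫ x in cyl n w, u x ∂μ = 0) : u =ᵐ[μ] 0 := by
  have hpos : ∫⁻ x, ENNReal.ofReal (u x) ∂μ ≠ ∞ := hu.lintegral_lt_top.ne
  have hneg : ∫⁻ x, ENNReal.ofReal (-u x) ∂μ ≠ ∞ := hu.neg.lintegral_lt_top.ne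
  have : IsFiniteMeasure (μ.withDensity fun x => ENNReal.ofReal (u x)) :=
    isFiniteMeasure_withDensity hpos
  have : IsFiniteMeasure (μ.withDensity fun x => ENNReal.ofReal (-u x)) :=
    isFiniteMeasure_withDensity hneg
  have heq : (μ.withDensity fun x => ENNReal.ofReal (u x)) =
      μ.withDensity fun x => ENNReal.ofReal (-u x) := by
    refine measure_eq_of_cyl fun n w => ?_
    rw [withDensity_apply _ (measurableSet_cyl n w), withDensity_apply _ (measurableSet_cyl n w)]
    have h0 := h n w
    rw [integral_eq_lintegral_pos_part_sub_lintegral_neg_part hu.restrict, sub_eq_zero] at h0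
    exact (ENNReal.toReal_eq_toReal_iff'
      (ne_top_of_le_ne_top hpos (setLIntegral_le_lintegral _ _))
      (ne_top_of_le_ne_top hneg (setLIntegral_le_lintegral _ _))).1 h0
  filter_upwards [(withDensity_eq_iff hu.1.aemeasurable.ennreal_ofReal
    hu.neg.1.aemeasurable.ennreal_ofReal hpos).1 heq] with x hx
  change ENNReal.ofReal (u x) = ENNReal.ofReal (-u x) at hx
  rcases lt_trichotomy (u x) 0 with h0 | h0 | h0
  · rw [ENNReal.ofReal_of_nonpos h0.le, eq_comm, ENNReal.ofReal_eq_zero] at hx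
    linarith
  · exact h0
  · rw [ENNReal.ofReal_of_nonpos (p := -u x) (by linarith), ENNReal.ofReal_eq_zero] at hx
    linarith

/-- An integrable function whose integrals over all cylinder sets vanish is zero. -/
theorem ae_eq_zero_of_forall_setIntegral_cyl [NeZero N] {u : Words N → ℂ}
    (hu : Integrable u μ) (h : ∀ n w, ∫ x in cyl n w, u x ∂μ = 0) : u =ᵐ[μ] 0 := by
  have hre : (fun x => RCLike.re (u x)) =ᵐ[μ] 0 :=
    ae_eq_zero_of_forall_setIntegral_cyl_real hu.re fun n w => by
      rw [integral_re hu.restrict, h, map_zero]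
  have him : (fun x => RCLike.im (u x)) =ᵐ[μ] 0 :=
    ae_eq_zero_of_forall_setIntegral_cyl_real hu.im fun n w => by
      rw [integral_im hu.restrict, h, map_zero]
  filter_upwards [hre, him] with x h1 h2
  exact RCLike.ext (by simpa using h1) (by simpa using h2)

/-- The set of the words that begin with a given finite word. -/
def wordSet : List (Fin N) → Set (Words N)
  | [] => Set.univ
  | j :: I => {x | x 0 = j} ∩ shift ⁻¹' wordSet I

theorem exists_wordSet_eq_cyl (n : ℕ) (w : Words N) : ∃ I, wordSet I = cyl n w := by
  induction n generalizing w with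
  | zero =>
    refine ⟨[w 0], ?_⟩
    rw [cyl_zero]
    simp [wordSet]
  | succ n ih =>
    obtain ⟨I, hI⟩ := ih (shift w)
    exact ⟨w 0 :: I, by rw [cyl_succ, wordSet, hI]⟩

end CylinderIntegrals

/-! ### Algebra of the operators `S_I S_I^*`. -/

section WordOp

variable {N : ℕ} {H : Type*} [NormedAddCommGroup H] [InnerProductSpace ℂ H] [CompleteSpace H]

theorem wordOp_nil_mul_adjoint_apply (S : Fin N → (H →L[ℂ] H)) (g : H) :
    (wordOp S [] * (wordOp S []).adjoint) g = g := by
  have h : wordOp S [] = 1 := rfl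
  rw [h, ← ContinuousLinearMap.star_eq_adjoint, star_one, mul_one]
  rfl

theorem wordOp_cons_mul_adjoint_apply (S : Fin N → (H →L[ℂ] H)) (j : Fin N) (I : List (Fin N))
    (g : H) :
    (wordOp S (j :: I) * (wordOp S (j :: I)).adjoint) g =
      S j ((wordOp S I * (wordOp S I).adjoint) ((S j).adjoint g)) := by
  have h : wordOp S (j :: I) = S j * wordOp S I := by simp [wordOp]
  rw [h, ← ContinuousLinearMap.star_eq_adjoint, star_mul]
  rfl

theorem wordOp_mul_adjoint_mem {S : Fin N → (H →L[ℂ] H)} {M : Submodule ℂ H}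
    (hM : ∀ i, ∀ x ∈ M, S i x ∈ M ∧ (S i).adjoint x ∈ M) (I : List (Fin N)) {g : H}
    (hg : g ∈ M) : (wordOp S I * (wordOp S I).adjoint) g ∈ M := by
  induction I generalizing g with
  | nil => rwa [wordOp_nil_mul_adjoint_apply]
  | cons j I ih =>
    rw [wordOp_cons_mul_adjoint_apply]
    exact (hM j _ (ih (hM j g hg).2)).1

end WordOp

namespace MarkovData

variable {N : ℕ} {d : MarkovData N}

/-! ### The representation on `L²` -/

variable (d) in
/-- The function `f_j (g ∘ σ)`. -/
noncomputable def branch (j : Fin N) (g : Words N → ℂ) (x : Words N) : ℂ :=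
  (d.f j x : ℂ) * g (shift x)

variable (d) in
/-- The constant function `1` as an element of `L²(μ)`. -/
noncomputable def oneLp : Lp ℂ 2 d.measure :=
  (memLp_const (1 : ℂ)).toLp

theorem coeFn_oneLp : ∀ᵐ x ∂d.measure, d.oneLp x = 1 :=
  (memLp_const (1 : ℂ)).coeFn_toLp

namespace IsQuasiStationary


/-- Change of variables along `map_shift_withDensity`; `u = |g|²` yields the isometry property. -/
theorem lintegral_f_sq_mul_comp_shift (hd : d.IsQuasiStationary) (j : Fin N) {u : Words N → ℝ≥0∞}
    (hu : AEMeasurable u d.measure) :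
    ∫⁻ x, ENNReal.ofReal (d.f j x ^ 2) * u (shift x) ∂d.measure = ∫⁻ x, u x ∂d.measure := by
  conv_rhs => rw [← hd.map_shift_withDensity j]
  rw [lintegral_map' (by rwa [hd.map_shift_withDensity j]) measurable_shift.aemeasurable]
  exact (lintegral_withDensity_eq_lintegral_mul₀
    ((hd.measurable_f j).pow_const 2).ennreal_ofReal.aemeasurable
    (hu.comp_quasiMeasurePreserving hd.quasiMeasurePreserving_shift)).symm

theorem aestronglyMeasurable_branch (hd : d.IsQuasiStationary) (j : Fin N) {g : Words N → ℂ}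
    (hg : AEStronglyMeasurable g d.measure) :
    AEStronglyMeasurable (d.branch j g) d.measure :=
  (Complex.measurable_ofReal.comp (hd.measurable_f j)).aestronglyMeasurable.mul
    (hg.comp_quasiMeasurePreserving hd.quasiMeasurePreserving_shift)

theorem eLpNorm_branch (hd : d.IsQuasiStationary) (j : Fin N) {g : Words N → ℂ} (hg : AEStronglyMeasurable g d.measure) :
    eLpNorm (d.branch j g) 2 d.measure = eLpNorm g 2 d.measure := by
  rw [eLpNorm_eq_lintegral_rpow_enorm_toReal two_ne_zero ENNReal.ofNat_ne_top,
    eLpNorm_eq_lintegral_rpow_enorm_toReal two_ne_zero ENNReal.ofNat_ne_top,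
    ← hd.lintegral_f_sq_mul_comp_shift j (hg.enorm.pow_const _)]
  congr 1
  refine lintegral_congr fun x => ?_
  rw [branch, enorm_mul, ENNReal.mul_rpow_of_nonneg _ _ (by simp), ← ofReal_norm,
    Complex.norm_real, Real.norm_of_nonneg (f_nonneg j x), ENNReal.ofReal_pow (f_nonneg j x)]
  simp

theorem memLp_branch (hd : d.IsQuasiStationary) (j : Fin N) {g : Words N → ℂ} (hg : MemLp g 2 d.measure) :
    MemLp (d.branch j g) 2 d.measure :=
  ⟨hd.aestronglyMeasurable_branch j hg.1, by rw [hd.eLpNorm_branch j hg.1]; exact hg.2⟩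

/-- Nonsingularity of the shift makes `g ∘ σ` meaningful for almost-everywhere classes. -/
theorem branch_congr (hd : d.IsQuasiStationary) (j : Fin N) {g h : Words N → ℂ} (hgh : g =ᵐ[d.measure] h) :
    d.branch j g =ᵐ[d.measure] d.branch j h := by
  filter_upwards [hd.quasiMeasurePreserving_shift.ae_eq_comp hgh] with x hx
  simp only [branch]
  rw [show g (shift x) = h (shift x) from hx]

variable (hd : d.IsQuasiStationary)

/-- The isometry `S_j g = f_j (g ∘ σ)` of `L²(μ)`. -/
noncomputable def repIsometry (j : Fin N) : Lp ℂ 2 d.measure →ₗᵢ[ℂ] Lp ℂ 2 d.measure where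
  toFun g := (hd.memLp_branch j (Lp.memLp g)).toLp
  map_add' g h := by
    rw [← MemLp.toLp_add, MemLp.toLp_eq_toLp_iff]
    refine (hd.branch_congr j (Lp.coeFn_add g h)).trans (ae_of_all _ fun x => ?_)
    exact mul_add _ _ _
  map_smul' c g := by
    rw [RingHom.id_apply, ← MemLp.toLp_const_smul, MemLp.toLp_eq_toLp_iff]
    refine (hd.branch_congr j (Lp.coeFn_smul c g)).trans (ae_of_all _ fun x => ?_)
    exact mul_left_comm _ _ _
  norm_map' g := by
    change ‖(hd.memLp_branch j (Lp.memLp g)).toLp‖ = _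
    rw [Lp.norm_toLp, hd.eLpNorm_branch j (Lp.memLp g).1, Lp.norm_def]

/-- The operators of the representation associated to quasi-stationary Markov data. -/
noncomputable def rep (j : Fin N) : Lp ℂ 2 d.measure →L[ℂ] Lp ℂ 2 d.measure :=
  (hd.repIsometry j).toContinuousLinearMap

theorem coeFn_rep (j : Fin N) (g : Lp ℂ 2 d.measure) :
    hd.rep j g =ᵐ[d.measure] d.branch j g :=
  (hd.memLp_branch j (Lp.memLp g)).coeFn_toLp

theorem isAssociatedRep_rep : d.IsAssociatedRep hd.rep := fun j _ hg =>
  (hd.coeFn_rep j _).trans (hd.branch_congr j hg.coeFn_toLp)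

theorem rep_adjoint_mul_self (j : Fin N) : (hd.rep j).adjoint * hd.rep j = 1 :=
  (ContinuousLinearMap.norm_map_iff_adjoint_comp_self (hd.rep j)).1 (hd.repIsometry j).norm_map

theorem rep_adjoint_rep (j : Fin N) (g : Lp ℂ 2 d.measure) :
    (hd.rep j).adjoint (hd.rep j g) = g :=
  DFunLike.congr_fun (hd.rep_adjoint_mul_self j) g

/-- The range of `S_j` is supported on the words beginning with `j`, so such a `g` is orthogonal to
it. -/
theorem rep_adjoint_eq_zero (j : Fin N) {g : Lp ℂ 2 d.measure}
    (hg : ∀ᵐ x ∂d.measure, x 0 = j → g x = 0) : (hd.rep j).adjoint g = 0 := by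
  refine ext_inner_right ℂ fun h => ?_
  rw [ContinuousLinearMap.adjoint_inner_left, inner_zero_left, L2.inner_def]
  refine integral_eq_zero_of_ae ?_
  filter_upwards [hg, hd.coeFn_rep j h] with x h1 h2
  by_cases hx : x 0 = j
  · simp [h1 hx]
  · simp [h2, branch, f_of_ne hx]

/-- The preimage is found by dividing by `f_j` along the inverse branch `x ↦ jx`; it is
square-integrable because `branch` preserves `eLpNorm` even before membership in `L²` is known. -/
theorem exists_rep_eq_indicator (j : Fin N) (g : Lp ℂ 2 d.measure) :
    ∃ h, hd.rep j h =ᵐ[d.measure] {x : Words N | x 0 = j}.indicator g := by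
  set u : Words N → ℂ := fun x => g (consWord j x) / (d.f j (consWord j x) : ℂ) with hu
  -- The representative of `g` is measurable everywhere, so composing it with `consWord j` requires
  -- no control of null sets.
  have hmeas : Measurable u :=
    ((Lp.stronglyMeasurable g).measurable.comp (measurable_consWord j)).div
      (Complex.measurable_ofReal.comp ((hd.measurable_f j).comp (measurable_consWord j)))
  have hbranch : d.branch j u = {x : Words N | x 0 = j}.indicator g := by
    funext x
    by_cases hx : x 0 = j
    · have hcons : consWord j (shift x) = x := by rw [← hx, consWord_shift]
      rw [Set.indicator_of_mem (s := {x : Words N | x 0 = j}) hx, branch, hu]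
      simp only [hcons]
      exact mul_div_cancel₀ _ (Complex.ofReal_ne_zero.2 (hd.f_pos hx).ne')
    · rw [Set.indicator_of_notMem (s := {x : Words N | x 0 = j}) hx, branch, f_of_ne hx]
      simp
  have hmem : MemLp u 2 d.measure := by
    refine ⟨hmeas.aestronglyMeasurable, ?_⟩
    rw [← hd.eLpNorm_branch j hmeas.aestronglyMeasurable, hbranch]
    exact ((Lp.memLp g).indicator (measurableSet_letter j)).2
  refine ⟨hmem.toLp, ?_⟩
  rw [← hbranch]
  exact hd.isAssociatedRep_rep j u hmem

/-- With `S_j h = 1_{x₁ = j} g`, the difference `g - S_j h` is killed by `S_j^*`, whence `S_j^* g =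
h`. -/
theorem rep_rep_adjoint (j : Fin N) (g : Lp ℂ 2 d.measure) :
    hd.rep j ((hd.rep j).adjoint g) =ᵐ[d.measure] {x : Words N | x 0 = j}.indicator g := by
  obtain ⟨h, hh⟩ := hd.exists_rep_eq_indicator j g
  have hzero : (hd.rep j).adjoint (g - hd.rep j h) = 0 := by
    refine hd.rep_adjoint_eq_zero j ?_
    filter_upwards [Lp.coeFn_sub g (hd.rep j h), hh] with x h1 h2 hx
    rw [h1, Pi.sub_apply, h2, Set.indicator_of_mem (s := {x : Words N | x 0 = j}) hx, sub_self]
  rw [map_sub, hd.rep_adjoint_rep, sub_eq_zero] at hzero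
  rwa [hzero]

theorem isCuntzRep_rep : IsCuntzRep hd.rep where
  adjoint_mul i j := by
    split_ifs with hij
    · rw [hij, hd.rep_adjoint_mul_self]
    · ext1 g
      refine hd.rep_adjoint_eq_zero i ?_
      filter_upwards [hd.coeFn_rep j g] with x hx hxi
      refine hx.trans ?_
      rw [branch, f_of_ne (fun h => hij (hxi.symm.trans h)), Complex.ofReal_zero, zero_mul]
  sum_mul_adjoint := by
    ext1 g
    rw [sum_apply]
    refine Lp.ext ?_
    have hall : ∀ᵐ x ∂d.measure, ∀ j, (hd.rep j * (hd.rep j).adjoint) g x =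
        {x : Words N | x 0 = j}.indicator g x :=
      ae_all_iff.2 fun j => hd.rep_rep_adjoint j g
    filter_upwards [Lp.coeFn_finsetSum Finset.univ fun j => (hd.rep j * (hd.rep j).adjoint) g,
      hall] with x h1 h2
    rw [h1, Finset.sum_apply, Finset.sum_congr rfl fun j _ => h2 j]
    simp [Set.indicator_apply]

/-- The projections `S_I S_I^*` are the multiplications with the indicators of cylinder sets. -/
theorem wordOp_mul_adjoint_apply (I : List (Fin N)) (g : Lp ℂ 2 d.measure) :
    (wordOp hd.rep I * (wordOp hd.rep I).adjoint) g =ᵐ[d.measure] (wordSet I).indicator g := by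
  induction I generalizing g with
  | nil =>
    rw [wordOp_nil_mul_adjoint_apply, wordSet, Set.indicator_univ]
  | cons j I ih =>
    classical
    rw [wordOp_cons_mul_adjoint_apply]
    filter_upwards [hd.coeFn_rep j ((wordOp hd.rep I * (wordOp hd.rep I).adjoint)
        ((hd.rep j).adjoint g)), hd.branch_congr j (ih ((hd.rep j).adjoint g)),
      hd.coeFn_rep j ((hd.rep j).adjoint g), hd.rep_rep_adjoint j g] with x h1 h2 h3 h4
    rw [h1, h2, wordSet, Set.inter_comm, ← Set.indicator_indicator, Set.indicator_apply, ← h4, h3]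
    simp [branch, Set.indicator_apply]

/-! ### Disjoint supports, monicity and irreducibility. -/

theorem inner_wordOp_mul_adjoint_apply (I : List (Fin N)) (g k : Lp ℂ 2 d.measure)
    (hI : MeasurableSet (wordSet I)) :
    inner ℂ ((wordOp hd.rep I * (wordOp hd.rep I).adjoint) g) k =
      ∫ x in wordSet I, inner ℂ (g x) (k x) ∂d.measure := by
  rw [L2.inner_def, ← integral_indicator hI]
  refine integral_congr_ae ?_
  filter_upwards [hd.wordOp_mul_adjoint_apply I g] with x hx
  rw [hx]
  by_cases h : x ∈ wordSet I <;> simp [h]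

/-- If `k` is orthogonal to all vectors `S_I S_I^* g`, then `g` and `k` have disjoint supports. -/
theorem ae_eq_zero_or_eq_zero {g k : Lp ℂ 2 d.measure}
    (h : ∀ I, inner ℂ ((wordOp hd.rep I * (wordOp hd.rep I).adjoint) g) k = 0) :
    ∀ᵐ x ∂d.measure, g x = 0 ∨ k x = 0 := by
  have := d.neZero
  have h0 : (fun x => inner ℂ (g x) (k x)) =ᵐ[d.measure] 0 := by
    refine ae_eq_zero_of_forall_setIntegral_cyl (L2.integrable_inner g k) fun n w => ?_
    obtain ⟨I, hI⟩ := exists_wordSet_eq_cyl n w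
    have := hd.inner_wordOp_mul_adjoint_apply I g k (hI ▸ measurableSet_cyl n w)
    rw [← hI, ← this, h]
  filter_upwards [h0] with x hx
  simpa [or_comm] using hx

theorem isMonicRep_rep : IsMonicRep hd.rep := by
  refine ⟨d.oneLp, dense_iff_closure_eq.1 ?_⟩
  rw [Submodule.dense_iff_topologicalClosure_eq_top, Submodule.topologicalClosure_eq_top_iff,
    Submodule.eq_bot_iff]
  intro k hk
  refine (Lp.eq_zero_iff_ae_eq_zero).2 ?_
  filter_upwards [hd.ae_eq_zero_or_eq_zero (g := d.oneLp) (k := k) fun I =>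
    (Submodule.mem_orthogonal _ _).1 hk _ (Submodule.subset_span ⟨I, rfl⟩), d.coeFn_oneLp]
    with x h1 h2
  exact h1.resolve_left (by simp [h2])

theorem isIrreducibleRep_rep : IsIrreducibleRep hd.rep := by
  have hne : ∀ᵐ x ∂d.measure, d.oneLp x ≠ 0 := d.coeFn_oneLp.mono fun x hx => by simp [hx]
  refine ⟨⟨⟨d.oneLp, 0, fun h => ?_⟩⟩, fun M hclosed hM => ?_⟩
  · obtain ⟨x, h1, h2⟩ := (hne.and ((Lp.eq_zero_iff_ae_eq_zero).1 h)).exists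
    exact h1 h2
  have : CompleteSpace M := hclosed.completeSpace_coe
  have hdisj : ∀ g ∈ M, ∀ k ∈ Mᗮ, ∀ᵐ x ∂d.measure, g x = 0 ∨ k x = 0 := fun g hg k hk =>
    hd.ae_eq_zero_or_eq_zero fun I =>
      (Submodule.mem_orthogonal _ _).1 hk _ (wordOp_mul_adjoint_mem hM I hg)
  set p := M.starProjection d.oneLp with hp
  set q := d.oneLp - p with hq
  have hpM : p ∈ M := Submodule.starProjection_apply_mem _ _
  have hqM : q ∈ Mᗮ := Submodule.sub_starProjection_mem_orthogonal _
  -- Invariance of `M` under the adjoints makes `Mᗮ` invariant under the `S_j`.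
  have hSq : ∀ j, hd.rep j q ∈ Mᗮ := fun j => by
    refine (Submodule.mem_orthogonal _ _).2 fun u hu => ?_
    rw [← ContinuousLinearMap.adjoint_inner_left]
    exact (Submodule.mem_orthogonal _ _).1 hqM _ (hM j u hu).2
  have hsum : ∀ᵐ x ∂d.measure, p x + q x = 1 := by
    filter_upwards [Lp.coeFn_sub d.oneLp p, d.coeFn_oneLp] with x h1 h2
    rw [hq, h1, Pi.sub_apply, h2]
    ring
  have hpq := hdisj p hpM q hqM
  -- Since `p + q = 1` with disjoint supports, `p` is an indicator. The support of `S_j p` avoids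
  -- that of `q`, and the support of `S_j q` avoids that of `p`; this gives the two implications.
  have hinv : shift ⁻¹' {x | p x ≠ 0} =ᵐ[d.measure] {x | p x ≠ 0} := by
    have hSp' : ∀ᵐ x ∂d.measure, ∀ j, d.branch j p x = 0 ∨ q x = 0 := ae_all_iff.2 fun j => by
      filter_upwards [hdisj _ (hM j p hpM).1 q hqM, hd.coeFn_rep j p] with x h1 h2
      rwa [h2] at h1
    have hSq' : ∀ᵐ x ∂d.measure, ∀ j, p x = 0 ∨ d.branch j q x = 0 := ae_all_iff.2 fun j => by
      filter_upwards [hdisj p hpM _ (hSq j), hd.coeFn_rep j q] with x h1 h2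
      rwa [h2] at h1
    refine Filter.eventuallyEq_set.2 ?_
    filter_upwards [hSp', hSq', hsum, hd.quasiMeasurePreserving_shift.ae hsum] with x h1 h2 h3 h4
    -- Only the branch `j = x 0` is nonzero at `x`, and it transfers the values at `shift x` to `x`.
    have hf : (d.f (x 0) x : ℂ) ≠ 0 := Complex.ofReal_ne_zero.2 (hd.f_pos rfl).ne'
    have h1 := h1 (x 0)
    have h2 := h2 (x 0)
    simp only [branch, mul_eq_zero, hf, false_or] at h1 h2
    change p (shift x) ≠ 0 ↔ p x ≠ 0
    constructor
    · intro h h'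
      rw [h1.resolve_left h, h'] at h3
      simp at h3
    · intro h h'
      rw [h2.resolve_left h, h'] at h4
      simp at h4
  have hmeas : NullMeasurableSet {x | p x ≠ 0} d.measure :=
    ((Lp.stronglyMeasurable p).measurable (measurableSet_singleton 0).compl).nullMeasurableSet
  -- The set is invariant only modulo null sets, so nonsingularity is used here together with
  -- ergodicity.
  rcases hd.quasiErgodic_shift.ae_mem_or_ae_notMem₀ hmeas hinv with h | h
  · right
    rw [← Submodule.orthogonal_eq_bot_iff, Submodule.eq_bot_iff]
    intro k hk
    refine (Lp.eq_zero_iff_ae_eq_zero).2 ?_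
    filter_upwards [h, hdisj p hpM k hk] with x h1 h2
    exact h2.resolve_left h1
  · left
    rw [Submodule.eq_bot_iff]
    intro g hg
    refine (Lp.eq_zero_iff_ae_eq_zero).2 ?_
    filter_upwards [h, hsum, hdisj g hg q hqM] with x h1 h2 h3
    refine h3.resolve_right fun hq0 => ?_
    have hp0 : p x = 0 := not_not.1 h1
    simp [hp0, hq0] at h2

end IsQuasiStationary

end MarkovData

theorem theorem3p4 (N : ℕ) (hN : 2 ≤ N) (d : MarkovData N) (hd : d.IsQuasiStationary) :
    QuasiErgodic (shift (N := N)) d.measure ∧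
      ∃ S : Fin N → (Lp ℂ 2 d.measure →L[ℂ] Lp ℂ 2 d.measure),
        d.IsAssociatedRep S ∧ IsCuntzRep S ∧ IsMonicRep S ∧ IsIrreducibleRep S := by
  exact ⟨hd.quasiErgodic_shift, hd.rep, hd.isAssociatedRep_rep, hd.isCuntzRep_rep,
    hd.isMonicRep_rep, hd.isIrreducibleRep_rep⟩
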